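/- Let $n\ge 1$ and $p\ge 0$ be integers, $a\in\mathbb{R}^p$, $b,c\in\mathbb{R}^n$, let $U$ be an open neighborhood of $(a,b)$ in $\mathbb{R}^{p+n}=\mathbb{R}^p\times\mathbb{R}^n$, and let $F:U\to\mathbb{R}^n$ be a function which is differentiable at every point of $U$ (not necessarily $C^1$), with $F(a,b)=c$. Write $D_xF=\left(\frac{\partial F_i}{\partial x_j}\right)$ (an $n\times p$ matrix) and $D_yF=\left(\frac{\partial F_i}{\partial y_j}\right)$ (an $n\times n$ matrix) for the matrices of partial derivatives of $F$ in the variables $x\in\mathbb{R}^p$ and $y\in\mathbb{R}^n$, and suppose that $D_yF(x,y)$ is invertible for all $(x,y)\in U$. Then there are: (i) an open neighborhood $V$ of $(a,b)$ in $\mathbb{R}^{p+n}$, contained in $U$; (ii) an open neighborhood $W$ of $(a,c)$ in $\mathbb{R}^{p+n}$; (iii) a unique function $G:W\to\mathbb{R}^n$ satisfying $G(a,c)=b$ and, for all $(x,z)\in W$, $(x,G(x,z))\in V$ and $F(x,G(x,z))=z$. Additionally, $G$ is differentiable at every point of $W$, and for all $(x,z)\in W$ its $n\times(p+n)$ Jacobian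 matrix is $$DG(x,z)=\left[\; -D_yF(x,G(x,z))^{-1}\,D_xF(x,G(x,z)) \;\middle|\; D_yF(x,G(x,z))^{-1}\;\right].$$ -/

import Mathlib

/-- The space of pairs `(x, y)` with `x ∈ ℝ^p` and `y ∈ ℝ^n`, that is, `ℝ^(p+n)`. -/
abbrev PairSpace (p n : ℕ) : Type :=
  EuclideanSpace ℝ (Fin p) × EuclideanSpace ℝ (Fin n)

/-- The `n × p` matrix `D_x F (q)` of the partial derivatives `∂F_i / ∂x_j` at `q = (x, y)`. -/
noncomputable def partialX {p n : ℕ} (F : PairSpace p n → EuclideanSpace ℝ (Fin n))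
    (q : PairSpace p n) : Matrix (Fin n) (Fin p) ℝ :=
  Matrix.of fun i j => lineDeriv ℝ (fun r => F r i) q (EuclideanSpace.single j 1, 0)

/-- The `n × n` matrix `D_y F (q)` of the partial derivatives `∂F_i / ∂y_j` at `q = (x, y)`. -/
noncomputable def partialY {p n : ℕ} (F : PairSpace p n → EuclideanSpace ℝ (Fin n))
    (q : PairSpace p n) : Matrix (Fin n) (Fin n) ℝ :=
  Matrix.of fun i j => lineDeriv ℝ (fun r => F r i) q (0, EuclideanSpace.single j 1)

/-- The `n × (p+n)` Jacobian matrix `DG (q)`: the matrix of the (Fréchet) derivative of `G` at `q`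
in the standard bases. The columns `Sum.inl j` belong to the first `p` coordinates, the columns
`Sum.inr j` to the last `n`. -/
noncomputable def jacobian {p n : ℕ} (G : PairSpace p n → EuclideanSpace ℝ (Fin n))
    (q : PairSpace p n) : Matrix (Fin n) (Fin p ⊕ Fin n) ℝ :=
  Matrix.of fun i => Sum.elim
    (fun j => fderiv ℝ G q (EuclideanSpace.single j 1, 0) i)
    (fun j => fderiv ℝ G q (0, EuclideanSpace.single j 1) i)

/-- On `W`, `G` solves `F (x, y) = z` for `y` as a function of `(x, z)`, with `(x, y)` in `V`, and
`G (a, c) = b`. -/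
structure SolvesOn {p n : ℕ} (F : PairSpace p n → EuclideanSpace ℝ (Fin n))
    (a : EuclideanSpace ℝ (Fin p)) (b c : EuclideanSpace ℝ (Fin n))
    (V W : Set (PairSpace p n)) (G : PairSpace p n → EuclideanSpace ℝ (Fin n)) : Prop where
  base : G (a, c) = b
  mem : ∀ x z, (x, z) ∈ W → (x, G (x, z)) ∈ V
  eq : ∀ x z, (x, z) ∈ W → F (x, G (x, z)) = z

/-! The map `(x, y) ↦ (x, F (x, y))` has invertible derivatives on `U`, so a local inverse of it
yields `G`; what is needed is an inverse function theorem without continuity of the derivative.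
Openness is elementary: a minimum of `‖f - y‖ ^ 2` inside a ball is a critical point, and
invertibility of the derivative forces `f = y` there. Local injectivity is the hard part. Suppose
the set `S` of points where it fails is nonempty. By Baire, `f` expands uniformly from the points of
`S` inside some closed ball `K` centred on `S`. Choose `u ≠ v` near the centre with `f u = f v = y`,
and let `f x'` be the point of `f '' (S ∩ K)` nearest to `y`. The open ball `B` about `y` with `f
x'` on its boundary misses both `f '' (S ∩ K)` and the image of the sphere of `K`, so `f` restricts
to a covering of `B` by a part of `K`. The fibre over `y` has two points, hence so has the fibre
over a point `p` of `B` close to `f x'`. Expansion puts both near `x'`, and differentiability at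
`x'` keeps the image of the segment joining them inside `B`. Since `B` is simply connected, the two
points coincide: a contradiction. -/

open Set Filter Topology Metric Asymptotics

/-! ### Coverings: path lifting and monodromy -/

section Covering

variable {Y B : Type*} [TopologicalSpace Y] [TopologicalSpace B] {p : Y → B}

/-- Two points of a covering space over a simply connected base which are joined by a path and have
the same image are equal. -/
theorem IsCoveringMap.eq_of_joined_of_apply_eq [SimplyConnectedSpace B] (cov : IsCoveringMap p)
    {e₁ e₂ : Y} (h : Joined e₁ e₂) (he : p e₁ = p e₂) : e₁ = e₂ := by
  obtain ⟨γ⟩ := h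
  let δ : Path (p e₁) (p e₁) := (γ.map cov.continuous).cast rfl he
  have h1 : cov.liftPath δ e₁ (by simp) = γ := by
    refine ((cov.eq_liftPath_iff' _).mpr ⟨?_, by simp⟩).symm
    ext t; simp [δ]
  -- The loop `δ` is null-homotopic, so its lift `γ` ends where the constant lift does.
  have h2 := cov.liftPath_apply_one_eq_of_homotopicRel
    (γ₀ := δ) (γ₁ := Path.refl (p e₁)) (SimplyConnectedSpace.paths_homotopic _ _) e₁
    (by simp) (by simp)
  have h3 : cov.liftPath (Path.refl (p e₁)) e₁ (by simp) = .const _ e₁ :=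
    cov.liftPath_const rfl
  rw [h1, h3] at h2
  simpa using h2.symm

/-- If one fibre of a covering of a path connected space has two distinct points, so has every
fibre. -/
theorem IsCoveringMap.exists_ne_of_apply_eq [PathConnectedSpace B] (cov : IsCoveringMap p)
    {e₁ e₂ : Y} (hne : e₁ ≠ e₂) (he : p e₁ = p e₂) (z : B) :
    ∃ d₁ d₂ : Y, d₁ ≠ d₂ ∧ p d₁ = z ∧ p d₂ = z := by
  let γ : Path.Homotopic.Quotient (p e₂) z := .mk (PathConnectedSpace.somePath _ _)
  let a₁ : p ⁻¹' {p e₂} := ⟨e₁, he⟩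
  let a₂ : p ⁻¹' {p e₂} := ⟨e₂, rfl⟩
  refine ⟨cov.monodromy γ a₁, cov.monodromy γ a₂, fun h => hne ?_,
    (cov.monodromy γ a₁).2, (cov.monodromy γ a₂).2⟩
  exact congrArg Subtype.val ((cov.monodromy_bijective γ).1 (Subtype.ext h))

end Covering

/-! ### Pointwise expansion from an invertible derivative -/

section LocalBehaviour

variable {E F : Type*} [NormedAddCommGroup E] [NormedSpace ℝ E]
  [NormedAddCommGroup F] [NormedSpace ℝ F] {f : E → F}

/-- A map with an invertible derivative at `x` is expanding from `x`, up to a constant. -/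
theorem HasFDerivAt.exists_eventually_mul_norm_sub_le {f' : E ≃L[ℝ] F} {x : E}
    (h : HasFDerivAt f (f' : E →L[ℝ] F) x) :
    ∃ c > 0, ∀ᶠ z in 𝓝 x, c * ‖z - x‖ ≤ ‖f z - f x‖ := by
  have A : (fun z => z - x) =O[𝓝 x] fun z => (f' : E →L[ℝ] F) (z - x) := f'.isBigO_sub_rev _ _
  have h1 : (fun z => f z - f x) ~[𝓝 x] fun z => (f' : E →L[ℝ] F) (z - x) :=
    h.isLittleO.trans_isBigO A
  obtain ⟨C, hC, hb⟩ := (A.trans h1.isBigO_symm).exists_pos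
  refine ⟨C⁻¹, inv_pos.2 hC, hb.bound.mono fun z hz => ?_⟩
  rwa [inv_mul_le_iff₀ hC]

end LocalBehaviour

/-! ### Openness, and local homeomorphisms on compact sets -/

section Euclidean

variable {E F : Type*} [NormedAddCommGroup E] [InnerProductSpace ℝ E] [FiniteDimensional ℝ E]
  [NormedAddCommGroup F] [InnerProductSpace ℝ F] {f : E → F} {Ω : Set E}

/-- If the distance from `f` to `y` is larger on a sphere than at its centre, and `f` has invertible
derivatives on the ball, then `f` takes the value `y` in the ball. -/
theorem exists_mem_ball_eq_of_forall_sphere_lt {x₀ : E} {ρ : ℝ} (hρ : 0 < ρ)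
    (hf : ∀ x ∈ closedBall x₀ ρ, ∃ f' : E ≃L[ℝ] F, HasFDerivAt f (f' : E →L[ℝ] F) x) {y : F}
    (hy : ∀ x ∈ sphere x₀ ρ, ‖f x₀ - y‖ < ‖f x - y‖) : ∃ x ∈ ball x₀ ρ, f x = y := by
  have hc : ContinuousOn f (closedBall x₀ ρ) := fun x hx => by
    obtain ⟨f', h⟩ := hf x hx
    exact h.continuousAt.continuousWithinAt
  obtain ⟨x, hx, hmin⟩ := (isCompact_closedBall x₀ ρ).exists_isMinOn
    ⟨x₀, mem_closedBall_self hρ.le⟩ (f := fun z => ‖f z - y‖) (hc.sub continuousOn_const).norm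
  have hxb : x ∈ ball x₀ ρ := by
    rw [← ball_union_sphere] at hx
    refine hx.resolve_right fun hs => ?_
    exact (hy x hs).not_ge (hmin (mem_closedBall_self hρ.le))
  refine ⟨x, hxb, ?_⟩
  obtain ⟨f', h⟩ := hf x (ball_subset_closedBall hxb)
  have hloc : IsLocalMin (fun z => ‖f z - y‖ ^ 2) x := by
    filter_upwards [isOpen_ball.mem_nhds hxb] with z hz
    have : ‖f x - y‖ ≤ ‖f z - y‖ := hmin (ball_subset_closedBall hz)
    gcongr
  have hd := (h.sub_const y).norm_sq
  have h0 := hloc.hasFDerivAt_eq_zero hd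
  -- The derivative `2⟪f x - y, f' ·⟫` vanishes; this direction turns it into `2‖f x - y‖ ^ 2`.
  have h1 := DFunLike.congr_fun h0 (f'.symm (f x - y))
  have h2 : inner ℝ (f x - y) (f x - y) = 0 := by
    rw [inner_sub_left, sub_eq_zero]
    simpa [inner_sub_left, sub_eq_zero] using h1
  exact sub_eq_zero.1 (inner_self_eq_zero.1 h2)

/-- A map with invertible derivatives near `x` is open at `x`. -/
theorem nhds_le_map_nhds_of_hasFDerivAt (hΩ : IsOpen Ω)
    (hf : ∀ x ∈ Ω, ∃ f' : E ≃L[ℝ] F, HasFDerivAt f (f' : E →L[ℝ] F) x) {x : E} (hx : x ∈ Ω) :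
    𝓝 (f x) ≤ map f (𝓝 x) := by
  intro s hs
  obtain ⟨f', h⟩ := hf x hx
  obtain ⟨c, hc, hb⟩ := h.exists_eventually_mul_norm_sub_le
  obtain ⟨ρ, hρ, hsub⟩ := nhds_basis_closedBall.mem_iff.1
    (inter_mem (inter_mem (mem_map.1 hs) (hΩ.mem_nhds hx)) hb)
  rw [Metric.mem_nhds_iff]
  -- On the sphere `‖f z - f x‖ ≥ c * ρ`, so any `y` within half of that is closer to `f x` than to
  -- `f z`.
  refine ⟨c * ρ / 2, by positivity, fun y hy => ?_⟩
  rw [mem_ball, dist_eq_norm] at hy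
  obtain ⟨z, hz, rfl⟩ := exists_mem_ball_eq_of_forall_sphere_lt hρ
    (fun z hz => hf z (hsub hz).1.2) (y := y) fun z hz => by
      have h1 : c * ‖z - x‖ ≤ ‖f z - f x‖ := (hsub (sphere_subset_closedBall hz)).2
      rw [mem_sphere_iff_norm.1 hz] at h1
      have h2 : ‖f z - f x‖ ≤ ‖f z - y‖ + ‖y - f x‖ := by
        simpa using norm_add_le (f z - y) (y - f x)
      rw [norm_sub_rev (f x)]
      linarith
  exact (hsub (ball_subset_closedBall hz)).1.1

/-- A map which is continuous, open and locally injective at the points of a compact set `K` lying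
over `s` restricts to a local homeomorphism of `K` over `s`. -/
theorem isLocalHomeomorphOn_comp_val {X Z : Type*} [TopologicalSpace X] [TopologicalSpace Z]
    {g : X → Z} {K : Set X} {s : Set Z} (hg : ContinuousOn g K)
    (hopen : ∀ x ∈ K, 𝓝 (g x) ≤ map g (𝓝 x))
    (hs : ∀ x ∈ K, g x ∈ s → K ∈ 𝓝 x ∧ ∃ U ∈ 𝓝 x, InjOn g U) :
    IsLocalHomeomorphOn (fun x : K => g x) ((fun x : K => g x) ⁻¹' s) := by
  rw [isLocalHomeomorphOn_iff_isOpenEmbedding_restrict]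
  rintro ⟨x, hx⟩ hxs
  obtain ⟨hK, U, hU, hinj⟩ := hs x hx hxs
  obtain ⟨O, hO, hOo, hxO⟩ := _root_.mem_nhds_iff.1 (inter_mem hK hU)
  have hopen' : IsOpen ((↑) ⁻¹' O : Set K) := hOo.preimage continuous_subtype_val
  refine ⟨(↑) ⁻¹' O, hopen'.mem_nhds hxO, ?_⟩
  refine .of_continuous_injective_isOpenMap ?_ ?_ ?_
  · exact (continuousOn_iff_continuous_domRestrict.1 hg).comp continuous_subtype_val
  · rintro ⟨⟨a, ha⟩, ha'⟩ ⟨⟨b, hb⟩, hb'⟩ h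
    have : a = b := hinj (hO ha').2 (hO hb').2 h
    subst this; rfl
  · rw [isOpenMap_iff_nhds_le]
    rintro ⟨⟨a, ha⟩, ha'⟩
    have hKa : K ∈ 𝓝 a := mem_of_superset (hOo.mem_nhds ha') fun z hz => (hO hz).1
    refine (hopen a ha).trans ?_
    have e1 : map ((↑) : K → X) (𝓝 ⟨a, ha⟩) = 𝓝 a := by
      rw [map_nhds_subtype_coe_eq_nhds ha hKa]
    have e2 : map ((↑) : ((↑) ⁻¹' O : Set K) → K) (𝓝 ⟨⟨a, ha⟩, ha'⟩) = 𝓝 ⟨a, ha⟩ :=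
      map_nhds_subtype_coe_eq_nhds ha' (hopen'.mem_nhds ha')
    rw [← e1, ← e2, map_map, map_map]
    rfl

/-- The points of `Ω` with no neighbourhood on which `f` is injective. -/
def nonInjectiveLocus {X Z : Type*} [TopologicalSpace X] (f : X → Z) (Ω : Set X) : Set X :=
  {x ∈ Ω | ∀ U ∈ 𝓝 x, ¬InjOn f U}

/-- Relative closedness makes the locus locally compact when `Ω` is open, so that Baire applies, and
makes its trace on a closed ball in `Ω` compact, so that a nearest image point exists. -/
theorem exists_isClosed_nonInjectiveLocus_eq {X Z : Type*} [TopologicalSpace X] (f : X → Z)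
    (Ω : Set X) : ∃ C, IsClosed C ∧ nonInjectiveLocus f Ω = Ω ∩ C := by
  refine ⟨{x | ∀ U ∈ 𝓝 x, ¬InjOn f U}, ?_, rfl⟩
  rw [← isOpen_compl_iff, isOpen_iff_mem_nhds]
  intro x hx
  simp only [mem_compl_iff, mem_ofPred_eq, not_forall, not_not] at hx
  obtain ⟨U, hU, hinj⟩ := hx
  obtain ⟨V, hVU, hV, hxV⟩ := _root_.mem_nhds_iff.1 hU
  filter_upwards [hV.mem_nhds hxV] with z hz
  simp only [mem_compl_iff, mem_ofPred_eq, not_forall, not_not]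
  exact ⟨U, mem_of_superset (hV.mem_nhds hz) hVU, hinj⟩

end Euclidean

/-! ### Uniform expansion by Baire category -/

section Baire

variable {E F : Type*} [NormedAddCommGroup E] [NormedAddCommGroup F] {f : E → F} {Ω S : Set E}

/-- If a continuous map is expanding from every point of a locally compact set `S`, then it is
uniformly so on some nonempty relatively open subset of `S`. -/
theorem exists_forall_mul_norm_sub_le [LocallyCompactSpace S] (hΩ : IsOpen Ω) (hSΩ : S ⊆ Ω)
    (hS : S.Nonempty) (hf : ContinuousOn f Ω)
    (hexp : ∀ s ∈ S, ∃ c > 0, ∀ᶠ z in 𝓝 s, c * ‖z - s‖ ≤ ‖f z - f s‖) :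
    ∃ x ∈ S, ∃ ρ > 0, ∃ c > 0, closedBall x ρ ⊆ Ω ∧
      ∀ s ∈ S ∩ closedBall x ρ, ∀ z ∈ closedBall x ρ, c * ‖z - s‖ ≤ ‖f z - f s‖ := by
  have : Nonempty S := hS.to_subtype
  -- A single parameter serves both as radius and as expansion constant, leaving countably many sets
  -- `A k`.
  let r : ℕ → ℝ := fun k => 1 / (k + 1)
  have hr : ∀ k, 0 < r k := fun k => Nat.one_div_pos_of_nat
  let A : ℕ → Set S := fun k => {s | ∀ z ∈ Ω, ‖z - s‖ < r k → r k * ‖z - s‖ ≤ ‖f z - f s‖}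
  have hA : ∀ k, IsClosed (A k) := by
    intro k
    have hfS : Continuous fun s : S => f s :=
      continuousOn_iff_continuous_domRestrict.1 (hf.mono hSΩ)
    have : A k = ⋂ z ∈ Ω, ({s : S | r k ≤ ‖z - s‖} ∪ {s : S | r k * ‖z - s‖ ≤ ‖f z - f s‖}) := by
      ext s
      simp only [A, mem_ofPred_eq, mem_iInter, mem_union, imp_iff_not_or]
      simp only [not_lt]
    rw [this]
    refine isClosed_biInter fun z _ => .union ?_ ?_
    · exact isClosed_le continuous_const (by fun_prop)
    · exact isClosed_le (by fun_prop) (continuous_const.sub hfS).norm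
  have hU : ⋃ k, A k = univ := by
    refine eq_univ_of_forall fun s => ?_
    obtain ⟨c, hc, h⟩ := hexp s s.2
    obtain ⟨ε, hε, hball⟩ := Metric.mem_nhds_iff.1 h
    obtain ⟨k, hk⟩ := exists_nat_one_div_lt (lt_min hc hε)
    refine mem_iUnion.2 ⟨k, fun z _ hz => ?_⟩
    have h1 : r k < min c ε := hk
    have h2 : c * ‖z - s‖ ≤ ‖f z - f s‖ :=
      hball (mem_ball_iff_norm.2 (hz.trans (h1.trans_le (min_le_right _ _))))
    have h3 : r k ≤ c := (h1.trans_le (min_le_left _ _)).le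
    exact le_trans (by gcongr) h2
  obtain ⟨k, x, hx⟩ := nonempty_interior_of_iUnion_of_closed hA hU
  rw [mem_interior_iff_mem_nhds, mem_nhds_subtype] at hx
  obtain ⟨u, hu, hux⟩ := hx
  obtain ⟨δ, hδ, hsub⟩ := nhds_basis_closedBall.mem_iff.1 (inter_mem hu (hΩ.mem_nhds (hSΩ x.2)))
  have hrk := hr k
  -- Two points of this ball are at distance at most `r k / 2 < r k`, as membership in `A k`
  -- requires.
  refine ⟨x, x.2, min δ (r k / 4), by positivity, r k, hrk, fun z hz => ?_, ?_⟩
  · exact (hsub (closedBall_subset_closedBall (min_le_left _ _) hz)).2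
  · rintro s ⟨hs, hsx⟩ z hz
    have hsA : (⟨s, hs⟩ : S) ∈ A k :=
      hux (hsub (closedBall_subset_closedBall (min_le_left _ _) hsx)).1
    refine hsA z (hsub (closedBall_subset_closedBall (min_le_left _ _) hz)).2 ?_
    rw [mem_closedBall_iff_norm] at hsx hz
    have h1 := min_le_right δ (r k / 4)
    have h2 : ‖z - s‖ ≤ ‖z - x‖ + ‖(x : E) - s‖ := by simpa using norm_add_le (z - x) ((x : E) - s)
    rw [norm_sub_rev (x : E)] at h2
    change ‖z - s‖ < r k
    linarith

end Baire

/-! ### Segments between preimages near a touching point -/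

section Touching

variable {E F : Type*} [NormedAddCommGroup E] [NormedSpace ℝ E] [NormedAddCommGroup F]
  [NormedSpace ℝ F] {f : E → F}

/-- If `f` has an invertible derivative at `x'` and is expanding from `x'` on a convex set `K`, then
for a point `y` and `p` on the segment from `y` to `f x'` close to `f x'`, the image of the segment
between two points of `K` over `p` stays in the ball with centre `y` and `f x'` on its boundary. -/
theorem exists_forall_segment_subset_preimage_ball {f' : E →L[ℝ] F} {x' : E}
    (h : HasFDerivAt f f' x') {K : Set E} {c : ℝ} (hc : 0 < c)
    (hexp : ∀ z ∈ K, c * ‖z - x'‖ ≤ ‖f z - f x'‖) {y : F} (hy : y ≠ f x') :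
    ∃ p ∈ ball y ‖y - f x'‖, ∀ u ∈ K, ∀ v ∈ K, f u = p → f v = p →
      segment ℝ u v ⊆ f ⁻¹' ball y ‖y - f x'‖ := by
  set d := ‖y - f x'‖ with hd
  have hd0 : 0 < d := norm_sub_pos_iff.2 hy
  -- the tolerance `ε`, at which the linear approximation holds on a ball of radius `δ`
  have hε : 0 < c / 4 := by positivity
  obtain ⟨δ, hδ, hball⟩ := Metric.mem_nhds_iff.1 (h.isLittleO.def hε)
  -- `τ < 1` keeps `p` strictly between `f x'` and `y`; `τ * d < c * δ` puts every point of `K` over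
  -- `p` within `δ` of `x'`.
  obtain ⟨τ, hτ0, hτ⟩ : ∃ τ : ℝ, 0 < τ ∧ τ < min 1 (c * δ / d) :=
    exists_between (by positivity)
  have hτ1 : τ < 1 := hτ.trans_le (min_le_left _ _)
  have hτ2 : τ * d < c * δ := (lt_div_iff₀ hd0).1 (hτ.trans_le (min_le_right _ _))
  have hpx : ‖(f x' + τ • (y - f x')) - f x'‖ = τ * d := by
    rw [add_sub_cancel_left, norm_smul, Real.norm_of_nonneg hτ0.le]
  have hpy : ‖(f x' + τ • (y - f x')) - y‖ = (1 - τ) * d := by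
    have : (f x' + τ • (y - f x')) - y = -((1 - τ) • (y - f x')) := by module
    rw [this, norm_neg, norm_smul, Real.norm_of_nonneg (by linarith)]
  generalize f x' + τ • (y - f x') = p at hpx hpy
  refine ⟨p, by rw [mem_ball_iff_norm, hpy]; nlinarith, ?_⟩
  have key : ∀ u ∈ K, f u = p → ‖u - x'‖ ≤ τ * d / c ∧
      ‖f' (u - x') - (p - f x')‖ ≤ τ * d / 4 := by
    intro u hu hup
    have h1 := hexp u hu
    rw [hup, hpx] at h1
    have h2 : ‖u - x'‖ ≤ τ * d / c := by rwa [le_div_iff₀ hc, mul_comm]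
    have h3 : u ∈ ball x' δ := by
      rw [mem_ball_iff_norm]
      exact h2.trans_lt (by rwa [div_lt_iff₀ hc, mul_comm δ])
    have h4 : ‖f u - f x' - f' (u - x')‖ ≤ c / 4 * ‖u - x'‖ := hball h3
    rw [hup, norm_sub_rev] at h4
    exact ⟨h2, h4.trans (by linarith)⟩
  intro u hu v hv hup hvp w hw
  obtain ⟨hu1, hu2⟩ := key u hu hup
  obtain ⟨hv1, hv2⟩ := key v hv hvp
  have hw1 : ‖w - x'‖ ≤ τ * d / c := by
    have := (convex_closedBall x' (τ * d / c)).segment_subset (x := u) (y := v)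
      (mem_closedBall_iff_norm.2 hu1) (mem_closedBall_iff_norm.2 hv1) hw
    exact mem_closedBall_iff_norm.1 this
  have hw2 : ‖f' (w - x') - (p - f x')‖ ≤ τ * d / 4 := by
    obtain ⟨a, b, ha, hb, hab, rfl⟩ := hw
    have e : f' (a • u + b • v - x') - (p - f x') =
        a • (f' (u - x') - (p - f x')) + b • (f' (v - x') - (p - f x')) := by
      obtain rfl : b = 1 - a := by linarith
      simp only [map_sub, map_add, map_smul]
      module
    rw [e]
    refine (norm_add_le _ _).trans ?_
    rw [norm_smul, norm_smul, Real.norm_of_nonneg ha, Real.norm_of_nonneg hb]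
    calc _ ≤ a * (τ * d / 4) + b * (τ * d / 4) := by gcongr
      _ = _ := by rw [← add_mul, hab, one_mul]
  have hw3 : ‖f w - f x' - f' (w - x')‖ ≤ τ * d / 4 := by
    have h3 : w ∈ ball x' δ := by
      rw [mem_ball_iff_norm]
      exact hw1.trans_lt (by rwa [div_lt_iff₀ hc, mul_comm δ])
    have h4 : ‖f w - f x' - f' (w - x')‖ ≤ c / 4 * ‖w - x'‖ := hball h3
    have h5 : c * ‖w - x'‖ ≤ τ * d := by rwa [le_div_iff₀ hc, mul_comm] at hw1
    linarith
  rw [mem_preimage, mem_ball_iff_norm]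
  have e : f w - y = (f w - f x' - f' (w - x')) + (f' (w - x') - (p - f x')) + (p - y) := by abel
  -- The two errors use up only half of the gain `τ * d`: the bound is `(1 - τ / 2) * d < d`.
  have h6 : ‖f w - y‖ ≤ τ * d / 4 + τ * d / 4 + (1 - τ) * d := by
    rw [e]
    refine (norm_add₃_le).trans ?_
    rw [hpy]
    gcongr
  have : 0 < τ * d := by positivity
  linarith

end Touching

/-! ### Local injectivity -/

section LocalInversion

variable {E F : Type*} [NormedAddCommGroup E] [InnerProductSpace ℝ E] [FiniteDimensional ℝ E]
  [NormedAddCommGroup F] [InnerProductSpace ℝ F] {f : E → F} {Ω : Set E}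

/-- An everywhere differentiable map with invertible derivatives is locally injective. -/
theorem exists_mem_nhds_injOn_of_hasFDerivAt (hΩ : IsOpen Ω)
    (hf : ∀ x ∈ Ω, ∃ f' : E ≃L[ℝ] F, HasFDerivAt f (f' : E →L[ℝ] F) x) {x : E} (hx : x ∈ Ω) :
    ∃ U ∈ 𝓝 x, InjOn f U := by
  by_contra hcon
  have hcont : ContinuousOn f Ω := fun z hz =>
    let ⟨_, h⟩ := hf z hz
    h.continuousAt.continuousWithinAt
  obtain ⟨C, hC, hSC⟩ := exists_isClosed_nonInjectiveLocus_eq f Ω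
  set S := nonInjectiveLocus f Ω with hS
  have hSΩ : S ⊆ Ω := fun z hz => hz.1
  have hxS : x ∈ S := ⟨hx, fun U hU hinj => hcon ⟨U, hU, hinj⟩⟩
  have : LocallyCompactSpace S := by
    rw [hSC]
    exact (hΩ.isLocallyClosed.inter hC.isLocallyClosed).locallyCompactSpace
  obtain ⟨x₁, hx₁, ρ, hρ, c, hc, hKΩ, hexp⟩ := exists_forall_mul_norm_sub_le hΩ hSΩ ⟨x, hxS⟩ hcont
    fun s hs => let ⟨_, h⟩ := hf s (hSΩ hs); h.exists_eventually_mul_norm_sub_le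
  set K := closedBall x₁ ρ with hK
  have hKc : IsCompact K := isCompact_closedBall _ _
  have hx₁K : x₁ ∈ S ∩ K := ⟨hx₁, mem_closedBall_self hρ.le⟩
  have hSK : IsCompact (S ∩ K) := by
    have : S ∩ K = K ∩ C := by
      rw [hSC]
      ext z
      exact ⟨fun h => ⟨h.2, h.1.2⟩, fun h => ⟨⟨hKΩ h.1, h.2⟩, h.1⟩⟩
    rw [this]
    exact hKc.inter_right hC
  -- two points `u ≠ v` near `x₁` with the same image `y`
  have hU : K ∩ f ⁻¹' ball (f x₁) (c * ρ / 2) ∈ 𝓝 x₁ :=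
    inter_mem (closedBall_mem_nhds _ hρ)
      ((hcont.continuousAt (hΩ.mem_nhds hx₁.1)) (ball_mem_nhds _ (by positivity)))
  have hninj := hx₁.2 _ hU
  simp only [InjOn, not_forall] at hninj
  obtain ⟨u, ⟨huK, hu⟩, v, ⟨hvK, -⟩, huv, hne⟩ := hninj
  rw [mem_preimage, mem_ball_iff_norm] at hu
  -- the point of `f '' (S ∩ K)` nearest to `y`
  obtain ⟨x', hx', hmin⟩ := hSK.exists_isMinOn ⟨x₁, hx₁K⟩ (f := fun z => ‖f u - f z‖)
    (continuousOn_const.sub (hcont.mono fun z hz => hz.1.1)).norm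
  have hmin' : ∀ s ∈ S ∩ K, ‖f u - f x'‖ ≤ ‖f u - f s‖ := fun s hs => hmin hs
  -- Otherwise expansion from `x'` would force `u = x' = v`.
  have hy : f u ≠ f x' := by
    intro h
    have h1 := hexp x' hx' u huK
    have h2 := hexp x' hx' v hvK
    rw [h, sub_self, norm_zero] at h1
    rw [← huv, h, sub_self, norm_zero] at h2
    have h3 : ‖u - x'‖ = 0 := by nlinarith [norm_nonneg (u - x')]
    have h4 : ‖v - x'‖ = 0 := by nlinarith [norm_nonneg (v - x')]
    exact hne ((sub_eq_zero.1 (norm_eq_zero.1 h3)).trans (sub_eq_zero.1 (norm_eq_zero.1 h4)).symm)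
  obtain ⟨f', hf'⟩ := hf x' hx'.1.1
  obtain ⟨p, hp, hseg⟩ := exists_forall_segment_subset_preimage_ball hf' hc (hexp x' hx') hy
  set B := ball (f u) ‖f u - f x'‖ with hB
  have hfB : f u ∈ B := mem_ball_self (norm_sub_pos_iff.2 hy)
  -- `f` restricts to a covering map over `B`
  have hloc : IsLocalHomeomorphOn (fun z : K => f z) ((fun z : K => f z) ⁻¹' B) := by
    refine isLocalHomeomorphOn_comp_val (hcont.mono hKΩ)
      (fun z hz => nhds_le_map_nhds_of_hasFDerivAt hΩ hf (hKΩ hz)) fun z hz hzB => ⟨?_, ?_⟩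
    · refine mem_of_superset (isOpen_ball.mem_nhds ?_) (ball_subset_closedBall (ε := ρ))
      rw [hB, mem_ball_iff_norm] at hzB
      have h1 := hexp x₁ hx₁K z hz
      have h2 := hmin' x₁ hx₁K
      have h3 : ‖f z - f x₁‖ ≤ ‖f z - f u‖ + ‖f u - f x₁‖ := by
        simpa using norm_add_le (f z - f u) (f u - f x₁)
      rw [mem_ball_iff_norm]
      exact lt_of_mul_lt_mul_left (a := c) (by linarith) hc.le
    -- A bad point over `B` would have its image strictly nearer to `f u` than `f x'`.
    · by_contra hcon
      have hzS : z ∈ S := ⟨hKΩ hz, fun U hU hinj => hcon ⟨U, hU, hinj⟩⟩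
      rw [hB, mem_ball_iff_norm, norm_sub_rev] at hzB
      exact hzB.not_ge (hmin' z ⟨hzS, hz⟩)
  have : CompactSpace K := isCompact_iff_compactSpace.1 hKc
  have hcov := (IsCoveringMapOn.of_isLocalHomeomorphOn
    (continuousOn_iff_continuous_domRestrict.1 (hcont.mono hKΩ)) hloc).isCoveringMap_restrictPreimage
  have : ContractibleSpace B := (convex_ball _ _).contractibleSpace ⟨_, hfB⟩
  obtain ⟨⟨⟨a, haK⟩, haB⟩, ⟨⟨b, hbK⟩, hbB⟩, hab, ha, hb⟩ := hcov.exists_ne_of_apply_eq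
    (e₁ := ⟨⟨u, huK⟩, hfB⟩) (e₂ := ⟨⟨v, hvK⟩, show f v ∈ B from huv ▸ hfB⟩)
    (fun h => hne (congrArg (fun z => (z.1 : E)) h)) (Subtype.ext huv) ⟨p, hp⟩
  have ha' : f a = p := congrArg Subtype.val ha
  have hb' : f b = p := congrArg Subtype.val hb
  -- The straight segment from `a` to `b` stays in `K` by convexity and over `B` by `hseg`.
  refine hab (hcov.eq_of_joined_of_apply_eq ?_ (ha.trans hb.symm))
  have hmem : ∀ t : unitInterval, AffineMap.lineMap a b (t : ℝ) ∈ segment ℝ a b := fun t => by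
    rw [segment_eq_image_lineMap]
    exact mem_image_of_mem _ t.2
  refine ⟨⟨⟨fun t => ⟨⟨AffineMap.lineMap a b (t : ℝ),
      (convex_closedBall _ _).segment_subset haK hbK (hmem t)⟩,
      hseg a haK b hbK ha' hb' (hmem t)⟩, ?_⟩, ?_, ?_⟩⟩
  · refine Continuous.subtype_mk (Continuous.subtype_mk ?_ _) _
    exact AffineMap.lineMap_continuous.comp continuous_subtype_val
  · simp
  · simp

end LocalInversion

/-! ### The inverse function theorem -/

section NormedSpace

variable {E : Type*} [NormedAddCommGroup E] [NormedSpace ℝ E] [FiniteDimensional ℝ E]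
  {f : E → E} {Ω : Set E}

/-- The inverse function theorem for everywhere differentiable maps. -/
theorem exists_local_inverse_of_hasFDerivAt (hΩ : IsOpen Ω)
    (hf : ∀ x ∈ Ω, ∃ f' : E ≃L[ℝ] E, HasFDerivAt f (f' : E →L[ℝ] E) x) {x : E} (hx : x ∈ Ω) :
    ∃ V ⊆ Ω, IsOpen V ∧ x ∈ V ∧ InjOn f V ∧ IsOpen (f '' V) ∧
      ∃ g : E → E, (∀ z ∈ V, g (f z) = z) ∧ ∀ z ∈ V, ∀ f' : E ≃L[ℝ] E,
        HasFDerivAt f (f' : E →L[ℝ] E) z → HasFDerivAt g (f'.symm : E →L[ℝ] E) (f z) := by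
  -- Openness and injectivity were proved with an inner product, which the sup norm of `PairSpace`
  -- does not provide; a linear change of coordinates supplies one.
  let e : E ≃L[ℝ] EuclideanSpace ℝ (Fin (Module.finrank ℝ E)) := toEuclidean
  let h := e ∘ f ∘ e.symm
  have hΩ' : IsOpen (e.symm ⁻¹' Ω) := hΩ.preimage e.symm.continuous
  have hh : ∀ w ∈ e.symm ⁻¹' Ω, ∃ h' : EuclideanSpace ℝ (Fin (Module.finrank ℝ E)) ≃L[ℝ]
      EuclideanSpace ℝ (Fin (Module.finrank ℝ E)),
      HasFDerivAt h (h' : EuclideanSpace ℝ (Fin (Module.finrank ℝ E)) →L[ℝ] _) w := fun w hw =>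
    let ⟨f', hf'⟩ := hf _ hw
    ⟨(e.symm.trans f').trans e, e.hasFDerivAt.comp w (hf'.comp w e.symm.hasFDerivAt)⟩
  have hmem : ∀ z ∈ Ω, e z ∈ e.symm ⁻¹' Ω := fun z hz => by simpa using hz
  have hopen : ∀ z ∈ Ω, 𝓝 (f z) ≤ map f (𝓝 z) := by
    intro z hz
    have h1 := nhds_le_map_nhds_of_hasFDerivAt hΩ' hh (hmem z hz)
    have h2 : h (e z) = e (f z) := by simp [h]
    have h3 : map e.symm (𝓝 (e z)) = 𝓝 z := by
      simpa using e.symm.toHomeomorph.map_nhds_eq (e z)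
    have h4 : map e (𝓝 (f z)) = 𝓝 (e (f z)) := e.toHomeomorph.map_nhds_eq (f z)
    rwa [h2, ← map_map, ← map_map, h3, ← h4, map_le_map_iff e.injective] at h1
  obtain ⟨U, hU, hinj⟩ : ∃ U ∈ 𝓝 x, InjOn f U := by
    obtain ⟨U, hU, hinj⟩ := exists_mem_nhds_injOn_of_hasFDerivAt hΩ' hh (hmem x hx)
    refine ⟨e ⁻¹' U, e.continuous.continuousAt hU, fun a ha b hb hab => ?_⟩
    exact e.injective (hinj ha hb (by simp [h, hab]))
  obtain ⟨V, hVU, hV, hxV⟩ := _root_.mem_nhds_iff.1 (inter_mem (hΩ.mem_nhds hx) hU)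
  have hVinj : InjOn f V := hinj.mono fun z hz => (hVU hz).2
  have hmap : ∀ z ∈ V, ∀ s ∈ 𝓝 z, f '' s ∈ 𝓝 (f z) := fun z hz s hs =>
    hopen z (hVU hz).1 (image_mem_map hs)
  have hgf : ∀ z ∈ V, Function.invFunOn f V (f z) = z := fun z hz => hVinj.leftInvOn_invFunOn hz
  refine ⟨V, fun z hz => (hVU hz).1, hV, hxV, hVinj, ?_, Function.invFunOn f V, hgf, ?_⟩
  · rw [isOpen_iff_mem_nhds]
    rintro _ ⟨z, hz, rfl⟩
    exact hmap z hz V (hV.mem_nhds hz)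
  · intro z hz f' hf'
    refine HasFDerivAt.of_local_left_inverse ?_ (by rwa [hgf z hz]) ?_
    -- Continuity of the inverse is openness of `f` at `z`.
    · rw [ContinuousAt, hgf z hz]
      intro s hs
      rw [mem_map]
      refine mem_of_superset (hmap z hz _ (inter_mem hs (hV.mem_nhds hz))) ?_
      rintro _ ⟨w, ⟨hws, hwV⟩, rfl⟩
      rwa [mem_preimage, hgf w hwV]
    · filter_upwards [hmap z hz V (hV.mem_nhds hz)]
      rintro _ ⟨w, hw, rfl⟩
      rw [hgf w hw]

end NormedSpace

/-! ### Partial derivatives and the implicit function theorem -/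

section ImplicitFunction

variable {n p : ℕ} {F : PairSpace p n → EuclideanSpace ℝ (Fin n)}

theorem partialX_apply {q : PairSpace p n} (hF : DifferentiableAt ℝ F q) (i : Fin n) (j : Fin p) :
    partialX F q i j = fderiv ℝ F q (EuclideanSpace.single j 1, 0) i := by
  have h : HasFDerivAt (fun r => F r i) _ q :=
    (EuclideanSpace.proj (𝕜 := ℝ) i).hasFDerivAt.comp q hF.hasFDerivAt
  simp [partialX, (h.hasLineDerivAt _).lineDeriv]

theorem partialY_apply {q : PairSpace p n} (hF : DifferentiableAt ℝ F q) (i j : Fin n) :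
    partialY F q i j = fderiv ℝ F q (0, EuclideanSpace.single j 1) i := by
  have h : HasFDerivAt (fun r => F r i) _ q :=
    (EuclideanSpace.proj (𝕜 := ℝ) i).hasFDerivAt.comp q hF.hasFDerivAt
  simp [partialY, (h.hasLineDerivAt _).lineDeriv]

/-- The derivative of `F` in terms of the matrices of its partial derivatives. -/
theorem fderiv_eq_partialX_mulVec_add_partialY_mulVec {q : PairSpace p n}
    (hF : DifferentiableAt ℝ F q) (r : PairSpace p n) :
    (fderiv ℝ F q r).ofLp = (partialX F q).mulVec r.1.ofLp + (partialY F q).mulVec r.2.ofLp := by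
  obtain ⟨v, w⟩ := r
  have hv : (v, (0 : EuclideanSpace ℝ (Fin n))) =
      ∑ j, v j • (EuclideanSpace.single j (1 : ℝ), (0 : EuclideanSpace ℝ (Fin n))) := by
    ext k <;> simp [Prod.fst_sum, Prod.snd_sum, Finset.sum_apply, Pi.single_apply]
  have hw : ((0 : EuclideanSpace ℝ (Fin p)), w) =
      ∑ j, w j • ((0 : EuclideanSpace ℝ (Fin p)), EuclideanSpace.single j (1 : ℝ)) := by
    ext k <;> simp [Prod.fst_sum, Prod.snd_sum, Finset.sum_apply, Pi.single_apply]
  have hvw : (v, w) = (v, (0 : EuclideanSpace ℝ (Fin n))) + ((0 : EuclideanSpace ℝ (Fin p)), w) := by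
    simp
  have hsum : fderiv ℝ F q (v, w) = ∑ j, v j • fderiv ℝ F q (EuclideanSpace.single j 1, 0) +
      ∑ j, w j • fderiv ℝ F q (0, EuclideanSpace.single j 1) := by
    rw [hvw, map_add, hv, hw]
    simp only [map_sum, map_smul]
  ext i
  rw [hsum]
  simp [Matrix.mulVec, dotProduct, partialX_apply hF, partialY_apply hF, mul_comm]

/-- The map `(x, y) ↦ (x, F (x, y))` has an invertible derivative where `D_y F` is invertible. -/
theorem exists_hasFDerivAt_prodMk_fst {q : PairSpace p n} (hF : DifferentiableAt ℝ F q)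
    (hinv : IsUnit (partialY F q)) :
    ∃ H' : PairSpace p n ≃L[ℝ] PairSpace p n,
      HasFDerivAt (fun r : PairSpace p n => (r.1, F r)) (H' : PairSpace p n →L[ℝ] PairSpace p n) q ∧
      ∀ r, (H'.symm r).2.ofLp =
        (partialY F q)⁻¹.mulVec (r.2.ofLp - (partialX F q).mulVec r.1.ofLp) := by
  let L : PairSpace p n →L[ℝ] PairSpace p n :=
    (ContinuousLinearMap.fst ℝ _ _).prod (fderiv ℝ F q)
  have hdet : IsUnit (partialY F q).det := (Matrix.isUnit_iff_isUnit_det _).1 hinv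
  have hL : ∀ r s, L r = s → r.1 = s.1 ∧
      r.2.ofLp = (partialY F q)⁻¹.mulVec (s.2.ofLp - (partialX F q).mulVec s.1.ofLp) := by
    rintro r s rfl
    refine ⟨rfl, ?_⟩
    have : (L r).2 = fderiv ℝ F q r := rfl
    rw [this, fderiv_eq_partialX_mulVec_add_partialY_mulVec hF]
    have : (L r).1 = r.1 := rfl
    rw [this, add_sub_cancel_left, Matrix.mulVec_mulVec, Matrix.nonsing_inv_mul _ hdet,
      Matrix.one_mulVec]
  have hLinj : Function.Injective (L : PairSpace p n →ₗ[ℝ] PairSpace p n) := by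
    intro r s h
    obtain ⟨h1, h2⟩ := hL r (L s) h
    obtain ⟨h3, h4⟩ := hL s (L s) rfl
    exact Prod.ext (h1.trans h3.symm) (WithLp.ofLp_injective 2 (h2.trans h4.symm))
  let H' : PairSpace p n ≃L[ℝ] PairSpace p n :=
    (LinearEquiv.ofInjectiveEndo (L : PairSpace p n →ₗ[ℝ] PairSpace p n)
      hLinj).toContinuousLinearEquiv
  have hH' : ∀ r, H' r = L r := fun r => rfl
  refine ⟨H', ?_, fun r => (hL _ r ?_).2⟩
  · have : (H' : PairSpace p n →L[ℝ] PairSpace p n) = L := ContinuousLinearMap.ext hH'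
    rw [this]
    exact hasFDerivAt_fst.prodMk hF.hasFDerivAt
  · rw [← hH', H'.apply_symm_apply]

end ImplicitFunction

theorem mainTheorem3 (n p : ℕ) (a : EuclideanSpace ℝ (Fin p)) (b c : EuclideanSpace ℝ (Fin n))
    (U : Set (PairSpace p n)) (hU : IsOpen U) (hab : (a, b) ∈ U)
    (F : PairSpace p n → EuclideanSpace ℝ (Fin n))
    (hF : DifferentiableOn ℝ F U) (hc : F (a, b) = c)
    (hinv : ∀ q ∈ U, IsUnit (partialY F q)) :
    ∃ V W : Set (PairSpace p n),
      IsOpen V ∧ (a, b) ∈ V ∧ V ⊆ U ∧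
      IsOpen W ∧ (a, c) ∈ W ∧
      ∃ G : PairSpace p n → EuclideanSpace ℝ (Fin n),
        SolvesOn F a b c V W G ∧
        (∀ G' : PairSpace p n → EuclideanSpace ℝ (Fin n),
          SolvesOn F a b c V W G' → Set.EqOn G' G W) ∧
        DifferentiableOn ℝ G W ∧
        ∀ x z, (x, z) ∈ W →
          jacobian G (x, z) =
            Matrix.fromCols
              (-((partialY F (x, G (x, z)))⁻¹ * partialX F (x, G (x, z))))
              ((partialY F (x, G (x, z)))⁻¹) := by

  have hFd : ∀ q ∈ U, DifferentiableAt ℝ F q := fun q hq => hF.differentiableAt (hU.mem_nhds hq)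
  obtain ⟨V, hVU, hV, habV, hinj, hW, g, hg, hgd⟩ := exists_local_inverse_of_hasFDerivAt
    (f := fun r : PairSpace p n => (r.1, F r)) hU
    (fun q hq => let ⟨H', h, _⟩ := exists_hasFDerivAt_prodMk_fst (hFd q hq) (hinv q hq); ⟨H', h⟩) hab
  have hgW : ∀ q ∈ V, (q.1, (g (q.1, F q)).2) = q := fun q hq => by rw [hg q hq]
  have hsol : SolvesOn F a b c V ((fun r : PairSpace p n => (r.1, F r)) '' V)
      fun r => (g r).2 := by
    refine ⟨?_, ?_, ?_⟩
    · have := hg (a, b) habV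
      simp only [hc] at this
      simp [this]
    · rintro x z ⟨q, hq, h⟩
      obtain ⟨rfl, rfl⟩ := Prod.mk.inj h
      rwa [hgW q hq]
    · rintro x z ⟨q, hq, h⟩
      obtain ⟨rfl, rfl⟩ := Prod.mk.inj h
      rw [hgW q hq]
  refine ⟨V, _, hV, habV, hVU, hW, ⟨(a, b), habV, by simp [hc]⟩, fun r => (g r).2, hsol, ?_, ?_, ?_⟩
  · rintro G' hG' ⟨x, z⟩ hxz
    -- Uniqueness needs no continuity of `G'`: both candidate points lie in `V`, where `(x, y) ↦ (x,
    -- F (x, y))` is injective.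
    have h := hinj (hG'.mem x z hxz) (hsol.mem x z hxz)
      (by simp only [hG'.eq x z hxz, hsol.eq x z hxz])
    exact (Prod.mk.inj h).2
  · rintro _ ⟨q, hq, rfl⟩
    obtain ⟨H', h, -⟩ := exists_hasFDerivAt_prodMk_fst (hFd q (hVU hq)) (hinv q (hVU hq))
    exact (hgd q hq H' h).snd.differentiableAt.differentiableWithinAt
  · rintro x z ⟨q, hq, h⟩
    obtain ⟨rfl, rfl⟩ := Prod.mk.inj h
    obtain ⟨H', h, hsymm⟩ := exists_hasFDerivAt_prodMk_fst (hFd q (hVU hq)) (hinv q (hVU hq))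
    have hd := (hgd q hq H' h).snd.fderiv
    have hent : ∀ r i, fderiv ℝ (fun r => (g r).2) (q.1, F q) r i = ((partialY F q)⁻¹.mulVec
        (r.2.ofLp - (partialX F q).mulVec r.1.ofLp)) i := fun r i => by
      rw [hd, ← hsymm r]
      rfl
    rw [hgW q hq]
    ext i (j | j)
    · simp [jacobian, hent, Matrix.mulVec_neg]
      rfl
    · simp [jacobian, hent]
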